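/- Let $\Omega$ be a finite nonempty alphabet with $A$ letters, let $k\ge 0$, and let $M(a\mid v)>0$ ($a\in\Omega$, $v\in\Omega^k$) be a $k$th-order Markov kernel with strictly positive entries, $\sum_{a\in\Omega}M(a\mid v)=1$ for every $v\in\Omega^k$. Let $\mathcal P(\Omega)$ be the set of strictly positive probability vectors on $\Omega$. Consider the time-homogeneous $k$th-order Markovian predictive game. Put $K_0=1$. In round $n=1,2,\dots$: Forecaster announces $p_n\in\mathcal P(\Omega)$, where $p_n(a)=M(a\mid\omega_{n-k}\cdots\omega_{n-1})$ for $n>k$, while the first $k$ forecasts are arbitrary (they may depend on the past moves of Reality); Skeptic announces $\alpha_n\in\mathbb R^\Omega$; Reality announces $\omega_n\in\Omega$; and \[ K_n=K_{n-1}\Bigl\{1+\sum_{a\in\Omega}\alpha_n(a)\bigl(\delta_{\omega_n}(a)-p_n(a)\bigr)\Bigr\}, \] where $\delta_{\omega_n}(a)=1$ if $\omega_n=a$ and $0$ otherwise. A strategy of Skeptic is called prudent if $K_n>0$ for all $n$ and all moves of Reality. Then there is exactly one probability distribution $\pi$ on $\Omega^k$ with $\pi(x_2\cdots x_{k+1})=\sum_{x_1\in\Omega}M(x_{k+1}\mid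 x_1\cdots x_k)\,\pi(x_1\cdots x_k)$ for all $x_2\cdots x_{k+1}\in\Omega^k$ (for $k=0$, $\pi$ is the point mass at the empty word), and $\pi>0$. For $\ell\ge k$ and $a^\ell=a_1\cdots a_\ell\in\Omega^\ell$ put \[ P(a^\ell)=\pi(a_1\cdots a_k)\prod_{i=k+1}^{\ell}M(a_i\mid a_{i-k}\cdots a_{i-1}), \] and let $S_n(a^\ell)$ be the number of (possibly overlapping) occurrences of $a^\ell$ in $\omega_1\cdots\omega_n$. Call $\omega_1\omega_2\cdots$ normal if $\lim_{n\to\infty}S_n(a^\ell)/n=P(a^\ell)$ for all $\ell\ge k$ and all $a^\ell\in\Omega^\ell$. (1) Skeptic has a strategy $\alpha:\Omega^*\to\mathbb R^\Omega$, $\alpha_n=\alpha(\omega_1\cdots\omega_{n-1})$, depending only on $M$ (not on Forecaster's first $k$ announcements), that is prudent and ensures $\lim_{n\to\infty}K_n=\infty$ unless $\omega_1\omega_2\cdots$ is normal. (2) The Lempel–Ziv betting strategy with banked gains is prudent and ensures $\lim_{n\to\infty}K_n=\infty$ unless $\omega_1\omega_2\cdots$ is normal. It is defined as follows. Parse $w=\omega_1\cdots\omega_{n-1}$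 incrementally from left to right, closing the current phrase as soon as it differs from all phrases closed before; let $\Phi$ be the set of closed phrases together with the empty word, let $\xi_0$ be the unfinished (possibly empty) last phrase, and let $V=\{ub: u\in\Phi,\ b\in\Omega\}\setminus\Phi$. Let \[ Q_{LZ}(a\mid w)=\frac{|\{\xi\in V:\ \xi_0a\text{ is a prefix of }\xi\}|}{|\{\xi\in V:\ \xi_0\text{ is a prefix of }\xi\}|}. \] The Lempel–Ziv betting strategy is $\alpha_n(a)=Q_{LZ}(a\mid\omega_1\cdots\omega_{n-1})/p_n(a)$. Its version with banked gains splits the capital into an amount in play (initially $1$) and an amount put aside (initially $0$); the bets $\alpha_n$ are applied to the amount in play only, and whenever after a round the amount in play is at least $2$, all of it except $1$ is put aside for good and the play goes on with $1$. Its capital $K_n$ is the sum of the two amounts. -/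

import Mathlib

open Filter Topology

namespace PredictiveGame

noncomputable section

variable {Ω : Type*} [Fintype Ω] [DecidableEq Ω]

/-! ### Markov kernels, stationary distributions, normal sequences -/

/-- A forecast: a strictly positive probability vector on the finite alphabet `Ω`. -/
def IsForecast (q : Ω → ℝ) : Prop :=
  (∀ a, 0 < q a) ∧ ∑ a, q a = 1

/-- `M a v` is the probability `M(a ∣ v)` of the letter `a` after the word `v` of length `k`. -/
def IsKernel {k : ℕ} (M : Ω → (Fin k → Ω) → ℝ) : Prop :=
  ∀ v, IsForecast (fun a => M a v)

/-- `π` is a probability distribution on words of length `k` with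
`π(x₂ ⋯ x_{k+1}) = ∑_{x₁} M(x_{k+1} ∣ x₁ ⋯ x_k) π(x₁ ⋯ x_k)`; below, `v` is `x₂ ⋯ x_{k+1}`, and
`Fin.cons c v` is the word `x₁ ⋯ x_{k+1}` with `x₁ = c`. -/
def IsStationary {k : ℕ} (M : Ω → (Fin k → Ω) → ℝ) (π : (Fin k → Ω) → ℝ) : Prop :=
  (∀ v, 0 ≤ π v) ∧ ∑ v, π v = 1 ∧
    ∀ v : Fin k → Ω, π v =
      ∑ c : Ω, (fun x : Fin (k + 1) → Ω => M (x (Fin.last k)) (Fin.init x) * π (Fin.init x))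
        (Fin.cons c v)

/-- `P(a₁ ⋯ a_ℓ) = π(a₁ ⋯ a_k) ∏_{i=k+1}^{ℓ} M(a_i ∣ a_{i-k} ⋯ a_{i-1})` for `ℓ ≥ k`; letters are
numbered from `0` here. -/
def jointProb {k : ℕ} (M : Ω → (Fin k → Ω) → ℝ) (π : (Fin k → Ω) → ℝ) {ℓ : ℕ} (h : k ≤ ℓ)
    (a : Fin ℓ → Ω) : ℝ :=
  π (fun j => a ⟨j, by omega⟩) *
    ∏ i : Fin (ℓ - k), M (a ⟨i + k, by omega⟩) (fun j => a ⟨i + j, by omega⟩)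

/-- `S_n(a)`: the number of (possibly overlapping) occurrences of the word `a` of length `ℓ` in the
first `n` letters `ω 0, …, ω (n - 1)` of the sequence `ω`. -/
def occurrences (ω : ℕ → Ω) (n : ℕ) {ℓ : ℕ} (a : Fin ℓ → Ω) : ℕ :=
  ((Finset.range (n + 1)).filter (fun i => i + ℓ ≤ n ∧ ∀ j : Fin ℓ, ω (i + j) = a j)).card

/-- The frequency of every word of length at least `k` converges to its stationary joint
probability. -/
def IsNormal {k : ℕ} (M : Ω → (Fin k → Ω) → ℝ) (π : (Fin k → Ω) → ℝ) (ω : ℕ → Ω) : Prop :=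
  ∀ (ℓ : ℕ) (h : k ≤ ℓ) (a : Fin ℓ → Ω),
    Tendsto (fun n : ℕ => (occurrences ω n a : ℝ) / n) atTop (𝓝 (jointProb M π h a))

/-! ### The game

Finite histories of Reality's moves are lists in chronological order. Both Forecaster's
announcements `p` and Skeptic's strategy `α` are functions of Reality's past moves. -/

/-- Forecaster announces elements of `𝒫(Ω)`, and from round `k + 1` on these are given by the kernel
`M` applied to the last `k` moves of Reality. The first `k` forecasts are free. -/
def FollowsKernel {k : ℕ} (M : Ω → (Fin k → Ω) → ℝ) (p : List Ω → Ω → ℝ) : Prop :=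
  (∀ w, IsForecast (p w)) ∧
    ∀ (u : List Ω) (v : Fin k → Ω) (a : Ω), p (u ++ List.ofFn v) a = M a v

/-- The factor `1 + ∑ₐ α(w)(a) (δ_x(a) - p(w)(a))` by which the capital is multiplied when Reality
plays `x` after the history `w`. -/
def gain (p α : List Ω → Ω → ℝ) (w : List Ω) (x : Ω) : ℝ :=
  1 + ∑ a, α w a * ((if x = a then 1 else 0) - p w a)

/-- The history formed by the first `n` moves of `ω`. -/
def history (ω : ℕ → Ω) (n : ℕ) : List Ω :=
  List.ofFn (fun i : Fin n => ω i)

/-- Skeptic's capital `K_n`. -/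
def capital (p α : List Ω → Ω → ℝ) (ω : ℕ → Ω) : ℕ → ℝ
  | 0 => 1
  | n + 1 => capital p α ω n * gain p α (history ω n) (ω n)

def IsPrudent (p α : List Ω → Ω → ℝ) : Prop :=
  ∀ (ω : ℕ → Ω) (n : ℕ), 0 < capital p α ω n

/-- Against the forecasts `p`, the strategy `α` is prudent and ensures `K_n → ∞` unless Reality's
moves satisfy `E`. -/
def Ensures (p α : List Ω → Ω → ℝ) (E : (ℕ → Ω) → Prop) : Prop :=
  IsPrudent p α ∧ ∀ ω : ℕ → Ω, ¬ E ω → Tendsto (capital p α ω) atTop atTop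

/-! ### The Lempel–Ziv betting strategy -/

/-- State of incremental parsing: the set of phrases parsed so far, and the current unfinished
phrase. -/
structure Parse (Ω : Type*) where
  phrases : Finset (List Ω)
  current : List Ω

/-- Read one letter: the current phrase is closed as soon as it is a new one. -/
def Parse.step (s : Parse Ω) (x : Ω) : Parse Ω :=
  if s.current ++ [x] ∈ s.phrases then ⟨s.phrases, s.current ++ [x]⟩
  else ⟨insert (s.current ++ [x]) s.phrases, []⟩

def parse (w : List Ω) : Parse Ω :=
  w.foldl Parse.step ⟨∅, []⟩

/-- The set `V` of candidates for the next phrase: one-letter extensions of the empty word or of a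
parsed phrase that are not themselves parsed phrases. -/
def Parse.candidates (s : Parse Ω) : Finset (List Ω) :=
  ((insert [] s.phrases ×ˢ (Finset.univ : Finset Ω)).image (fun ub => ub.1 ++ [ub.2])) \
    insert [] s.phrases

/-- `Q_LZ(a ∣ w)`: the fraction of those candidates extending the unfinished phrase that continue
with the letter `a`. -/
def lzProb (w : List Ω) (a : Ω) : ℝ :=
  (((parse w).candidates.filter (fun ξ => (parse w).current ++ [a] <+: ξ)).card : ℝ) /
    (((parse w).candidates.filter (fun ξ => (parse w).current <+: ξ)).card : ℝ)

/-- The Lempel–Ziv betting strategy `α(w)(a) = Q_LZ(a ∣ w) / p(w)(a)`. -/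
def lzStrategy (p : List Ω → Ω → ℝ) (w : List Ω) (a : Ω) : ℝ :=
  lzProb w a / p w a

/-! ### Banking the gains -/

/-- The moves made so far, the money in play, and the money put aside. -/
structure Accounts (Ω : Type*) where
  past : List Ω
  active : ℝ
  storage : ℝ

/-- The money in play evolves under `α`; once it reaches or exceeds `2`, everything above `1` is put
aside and the game goes on with `1` in play. -/
def Accounts.step (p α : List Ω → Ω → ℝ) (s : Accounts Ω) (x : Ω) : Accounts Ω :=
  if 2 ≤ s.active * gain p α s.past x then
    ⟨s.past ++ [x], 1, s.storage + (s.active * gain p α s.past x - 1)⟩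
  else ⟨s.past ++ [x], s.active * gain p α s.past x, s.storage⟩

def accounts (p α : List Ω → Ω → ℝ) (w : List Ω) : Accounts Ω :=
  w.foldl (Accounts.step p α) ⟨[], 1, 0⟩

/-- The modification of `α` that bets with the money in play only. As bets are expressed as
multiples of the total capital, `α` is scaled by the proportion of the money in play. -/
def banked (p α : List Ω → Ω → ℝ) (w : List Ω) (a : Ω) : ℝ :=
  (accounts p α w).active / ((accounts p α w).active + (accounts p α w).storage) * α w a

end

end PredictiveGame

/-! Without banking, the Lempel–Ziv capital is the likelihood ratio of `lzProb` to the forecasts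
(`capital_lzStrategy`). The core fact is that `lzProb` dominates, up to a subexponential factor,
every finite-memory probability (`wordProb_le_wordProb_lzProb`). On a word with `c` closed phrases
and `A` letters, its Lempel–Ziv probability is at least `1 / (A ^ (c + 1) * (c + 1)!)`, since each
closed phrase is picked from at most `A * (j + 1)` candidates when `j` phrases precede it. A
finite-memory probability damped by `t < 1` per letter has finite total weight over all words, from
each of finitely many states; as the phrases are distinct, the product of their weights is at most
`C ^ c / c!`. The factorials cancel up to the factor `c + 1`, `c` is sublinear in the length `n`,
and the damping costs only `t ^ n` with `t` as close to `1` as desired.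

If `ω` is not normal, then after some word `v` of length at least `k` the average excess of some
letter over its forecast does not tend to `0` (`isNormal_of_tendsto_excess`). Tilting the forecasts
for or against that letter after `v` gives a finite-memory probability that beats the forecasts
exponentially, infinitely often. By domination the Lempel–Ziv capital is then unbounded, and banking
turns unboundedness into divergence to infinity.

A strategy that does not see the first `k` forecasts arises by playing against fictitious ones on
which the Lempel–Ziv strategy places no bet. -/

namespace PredictiveGame

/-! ### Existence, uniqueness and positivity of the stationary distribution. -/

section Stationary

variable {Ω : Type*} [Fintype Ω] {k : ℕ}

/-- The action of the kernel `M` on (signed) measures on words of length `k`. -/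
noncomputable def transfer (M : Ω → (Fin k → Ω) → ℝ) :
    ((Fin k → Ω) → ℝ) →ₗ[ℝ] ((Fin k → Ω) → ℝ) where
  toFun d v := ∑ c : Ω, (fun x : Fin (k + 1) → Ω => M (x (Fin.last k)) (Fin.init x) *
    d (Fin.init x)) (Fin.cons c v)
  map_add' d e := by
    ext v; simp [mul_add, Finset.sum_add_distrib]
  map_smul' r d := by
    ext v; simp only [Pi.smul_apply, smul_eq_mul, RingHom.id_apply, Finset.mul_sum]
    exact Finset.sum_congr rfl fun _ _ => by ring

lemma sum_words_cons (f : (Fin (k + 1) → Ω) → ℝ) :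
    ∑ v : Fin k → Ω, ∑ c : Ω, f (Fin.cons c v) = ∑ x, f x := by
  rw [Finset.sum_comm, ← Fintype.sum_prod_type' (f := fun c (v : Fin k → Ω) => f (Fin.cons c v))]
  exact Fintype.sum_equiv (Fin.consEquiv fun _ : Fin (k + 1) => Ω) _ _ fun _ => rfl

lemma sum_words_snoc (f : (Fin (k + 1) → Ω) → ℝ) :
    ∑ v : Fin k → Ω, ∑ a : Ω, f (Fin.snoc v a) = ∑ x, f x := by
  rw [Finset.sum_comm,
    ← Fintype.sum_prod_type' (f := fun a (v : Fin k → Ω) => f (Fin.snoc v a))]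
  exact Fintype.sum_equiv (Fin.snocEquiv fun _ : Fin (k + 1) => Ω) _ _ fun _ => rfl

/-- Both sums run over words of length `k + 1`, split off once at the first letter and once at the
last; the kernel sums to `1` over the last letter. -/
lemma sum_transfer {M : Ω → (Fin k → Ω) → ℝ} (hM : IsKernel M) (d : (Fin k → Ω) → ℝ) :
    ∑ v, transfer M d v = ∑ v, d v := by
  have h := sum_words_cons (fun x : Fin (k + 1) → Ω => M (x (Fin.last k)) (Fin.init x) *
    d (Fin.init x))
  have h' := sum_words_snoc (fun x : Fin (k + 1) → Ω => M (x (Fin.last k)) (Fin.init x) *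
    d (Fin.init x))
  change ∑ v : Fin k → Ω, ∑ c : Ω, _ = _
  rw [h, ← h']
  refine Finset.sum_congr rfl fun v _ => ?_
  simp only [Fin.snoc_last, Fin.init_snoc]
  rw [← Finset.sum_mul, (hM v).2, one_mul]

/-- A fixed nonnegative measure charging one word charges every word. -/
lemma pos_of_transfer_eq {M : Ω → (Fin k → Ω) → ℝ} (hM : IsKernel M)
    {d : (Fin k → Ω) → ℝ} (hd : ∀ v, 0 ≤ d v) (hT : transfer M d = d) {u : Fin k → Ω}
    (hu : 0 < d u) (v : Fin k → Ω) : 0 < d v := by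
  rcases Nat.eq_zero_or_pos k with rfl | hk
  · rwa [Subsingleton.elim v u]
  -- The word `u` followed by `v`: sliding a window of length `k` from position `0` to `k` carries
  -- positivity from `u` to `v`. The `% k` only makes the sequence total.
  let x : ℕ → Ω := fun j => if h : j < k then u ⟨j, h⟩ else v ⟨(j - k) % k, Nat.mod_lt _ hk⟩
  have key : ∀ i, 0 < d (fun j : Fin k => x (i + j)) := by
    intro i
    induction i with
    | zero =>
      convert hu using 2
      ext j
      simp [x]
    | succ i ih =>
      rw [← hT]
      have hcons : (Fin.cons (x i) (fun j : Fin k => x (i + 1 + j)) : Fin (k + 1) → Ω) =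
          fun j : Fin (k + 1) => x (i + j) := by
        ext j
        refine Fin.cases ?_ (fun j => ?_) j
        · simp
        · simp only [Fin.cons_succ, Fin.val_succ]; congr 1; ring
      refine lt_of_lt_of_le ?_ (Finset.single_le_sum
        (f := fun c => (fun x : Fin (k + 1) → Ω => M (x (Fin.last k)) (Fin.init x) *
          d (Fin.init x)) (Fin.cons c (fun j : Fin k => x (i + 1 + j))))
        (fun c _ => mul_nonneg ((hM _).1 _).le (hd _)) (Finset.mem_univ (x i)))
      simp only [hcons]
      exact mul_pos ((hM _).1 _) ih
  convert key k using 2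
  ext j
  simp [x, Nat.mod_eq_of_lt j.2]

lemma IsStationary.transfer_eq {M : Ω → (Fin k → Ω) → ℝ} {d : (Fin k → Ω) → ℝ}
    (h : IsStationary M d) : transfer M d = d :=
  funext fun v => (h.2.2 v).symm

lemma IsStationary.pos {M : Ω → (Fin k → Ω) → ℝ} (hM : IsKernel M) {d : (Fin k → Ω) → ℝ}
    (h : IsStationary M d) (v : Fin k → Ω) : 0 < d v := by
  obtain ⟨u, -, hu⟩ : ∃ u ∈ Finset.univ, 0 < d u := by
    by_contra! hc
    have := Finset.sum_nonpos hc
    rw [h.2.1] at this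
    linarith
  exact pos_of_transfer_eq hM h.1 h.transfer_eq hu v

/-- Subtracting from `e` the largest multiple of `d` that stays below it leaves a nonnegative fixed
measure with a zero, which must vanish identically. -/
lemma IsStationary.unique [Nonempty Ω] {M : Ω → (Fin k → Ω) → ℝ} (hM : IsKernel M)
    {d e : (Fin k → Ω) → ℝ} (hd : IsStationary M d) (he : IsStationary M e) : e = d := by
  obtain ⟨u, hu⟩ := Finite.exists_min (fun v => e v / d v)
  set t := e u / d u with ht
  have hT : transfer M (e - t • d) = e - t • d := by
    rw [map_sub, map_smul, hd.transfer_eq, he.transfer_eq]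
  have hnn : ∀ v, 0 ≤ (e - t • d) v := fun v => by
    have := (le_div_iff₀ (hd.pos hM v)).1 (hu v)
    simpa using this
  have hz : (e - t • d) u = 0 := by
    have := (hd.pos hM u).ne'
    simp [ht, this]
  have hall : ∀ v, (e - t • d) v = 0 := fun v => by
    by_contra hne
    have := pos_of_transfer_eq hM hnn hT (lt_of_le_of_ne (hnn v) (Ne.symm hne)) u
    exact this.ne' hz
  have hev : ∀ v, e v = t * d v := fun v => by simpa [sub_eq_zero] using hall v
  have ht1 : t = 1 := by
    have := he.2.1
    rwa [Finset.sum_congr rfl fun v _ => hev v, ← Finset.mul_sum, hd.2.1, mul_one] at this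
  ext v
  rw [hev, ht1, one_mul]

/-- Mass conservation puts the range of `transfer M - id` in the vectors of sum `0`, so in finite
dimension it has a nonzero kernel vector `d`. Then `|d| ≤ transfer M |d|` pointwise with equal sums,
so `|d|` is fixed and can be normalized. -/
lemma exists_isStationary [Nonempty Ω] {M : Ω → (Fin k → Ω) → ℝ} (hM : IsKernel M) :
    ∃ d, IsStationary M d := by
  have hns : ¬ Function.Surjective (transfer M - LinearMap.id : _ →ₗ[ℝ] ((Fin k → Ω) → ℝ)) := by
    intro hs
    obtain ⟨d, hd⟩ := hs (fun _ => 1)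
    have h1 : ∑ v, (transfer M - LinearMap.id : _ →ₗ[ℝ] ((Fin k → Ω) → ℝ)) d v = 0 := by
      simp [Finset.sum_sub_distrib, sum_transfer hM]
    rw [hd] at h1
    simp at h1
  have hni : ¬ Function.Injective (transfer M - LinearMap.id : _ →ₗ[ℝ] ((Fin k → Ω) → ℝ)) :=
    fun h => hns (LinearMap.injective_iff_surjective.1 h)
  rw [← LinearMap.ker_eq_bot, Submodule.eq_bot_iff] at hni
  push Not at hni
  obtain ⟨d, hd, hd0⟩ := hni
  have hTd : transfer M d = d := by
    simpa [sub_eq_zero] using hd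
  have hle : ∀ v, |d v| ≤ transfer M (fun v => |d v|) v := fun v => by
    conv_lhs => rw [← hTd]
    refine (Finset.abs_sum_le_sum_abs _ _).trans (Finset.sum_le_sum fun c _ => ?_)
    simp only [abs_mul]
    rw [abs_of_pos ((hM _).1 _)]
  have heq : ∀ v, |d v| = transfer M (fun v => |d v|) v := by
    have := (Finset.sum_eq_sum_iff_of_le (fun v _ => hle v)).1
      (sum_transfer hM (fun v => |d v|)).symm
    exact fun v => this v (Finset.mem_univ v)
  obtain ⟨u, hu⟩ := Function.ne_iff.1 hd0
  have hpos : 0 < ∑ v, |d v| :=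
    Finset.sum_pos' (fun v _ => abs_nonneg _) ⟨u, Finset.mem_univ u, abs_pos.2 hu⟩
  set s := ∑ v, |d v|
  refine ⟨s⁻¹ • fun v => |d v|, fun v => ?_, ?_, fun v => ?_⟩
  · simp only [Pi.smul_apply, smul_eq_mul]; positivity
  · simp only [Pi.smul_apply, smul_eq_mul, ← Finset.mul_sum]
    exact inv_mul_cancel₀ hpos.ne'
  · change _ = transfer M (s⁻¹ • fun v => |d v|) v
    rw [map_smul, Pi.smul_apply, Pi.smul_apply, ← heq]

end Stationary

/-! ### From unbiased forecasts to normality. -/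

section Frequencies

variable {Ω : Type*} {k ℓ : ℕ}

/-- Indicator of the event that the word `v` occurs in `ω` at position `i`. -/
noncomputable def occursAt [DecidableEq Ω] (ω : ℕ → Ω) (v : Fin ℓ → Ω) (i : ℕ) : ℝ :=
  if ∀ j : Fin ℓ, ω (i + j) = v j then 1 else 0

/-- Relative frequency of the starting positions of `v` among the first `n` positions. -/
noncomputable def startFreq [DecidableEq Ω] (ω : ℕ → Ω) (n : ℕ) (v : Fin ℓ → Ω) : ℝ :=
  (∑ i ∈ Finset.range n, occursAt ω v i) / n

/-- After the history `w`, if it ends with `v`, the excess of the indicator of `x = a` over the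
forecast of the letter `a`. -/
noncomputable def excess [DecidableEq Ω] (p : List Ω → Ω → ℝ) (v : List Ω) (a : Ω) (w : List Ω)
    (x : Ω) : ℝ :=
  if v <:+ w then (if x = a then 1 else 0) - p w a else 0

lemma occursAt_nonneg [DecidableEq Ω] (ω : ℕ → Ω) (v : Fin ℓ → Ω) (i : ℕ) : 0 ≤ occursAt ω v i := by
  unfold occursAt; split_ifs <;> norm_num

lemma occursAt_le_one [DecidableEq Ω] (ω : ℕ → Ω) (v : Fin ℓ → Ω) (i : ℕ) : occursAt ω v i ≤ 1 := by
  unfold occursAt; split_ifs <;> norm_num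

lemma abs_occursAt_le_one [DecidableEq Ω] (ω : ℕ → Ω) (v : Fin ℓ → Ω) (i : ℕ) :
    |occursAt ω v i| ≤ 1 :=
  abs_le.2 ⟨by linarith [occursAt_nonneg ω v i], occursAt_le_one ω v i⟩

lemma IsForecast.le_one [Fintype Ω] {q : Ω → ℝ} (hq : IsForecast q) (a : Ω) : q a ≤ 1 := by
  rw [← hq.2]
  exact Finset.single_le_sum (fun b _ => (hq.1 b).le) (Finset.mem_univ a)

lemma abs_excess_le_one [Fintype Ω] [DecidableEq Ω] {p : List Ω → Ω → ℝ}
    (hp : ∀ w, IsForecast (p w)) (v : List Ω) (a : Ω) (w : List Ω) (x : Ω) :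
    |excess p v a w x| ≤ 1 := by
  have h0 := (hp w).1 a
  have h1 := (hp w).le_one a
  unfold excess
  rw [abs_le]
  split_ifs <;> constructor <;> linarith

lemma abs_sum_range_sub_le {f : ℕ → ℝ} (hf : ∀ i, |f i| ≤ 1) {m n c : ℕ} (h : m ≤ n + c)
    (h' : n ≤ m + c) :
    |∑ i ∈ Finset.range m, f i - ∑ i ∈ Finset.range n, f i| ≤ c := by
  wlog hmn : n ≤ m generalizing m n
  · rw [abs_sub_comm]
    exact this h' h (by omega)
  rw [← Finset.sum_Ico_eq_sub _ hmn]
  refine (Finset.abs_sum_le_sum_abs _ _).trans ((Finset.sum_le_sum fun i _ => hf i).trans ?_)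
  simp only [Finset.sum_const, Nat.card_Ico, nsmul_eq_mul, mul_one]
  exact_mod_cast (by omega : m - n ≤ c)

lemma tendsto_div_natCast_of_abs_le {u : ℕ → ℝ} {c : ℝ} (h : ∀ n, |u n| ≤ c) :
    Tendsto (fun n : ℕ => u n / n) atTop (𝓝 0) := by
  refine squeeze_zero_norm (fun n => ?_) (tendsto_const_div_atTop_nhds_zero_nat c)
  rw [Real.norm_eq_abs, abs_div, Nat.abs_cast]
  exact div_le_div_of_nonneg_right (h n) (Nat.cast_nonneg n)

lemma occurrences_eq_sum [DecidableEq Ω] (ω : ℕ → Ω) (n : ℕ) (v : Fin ℓ → Ω) :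
    (occurrences ω n v : ℝ) = ∑ i ∈ Finset.range (n + 1 - ℓ), occursAt ω v i := by
  unfold occurrences occursAt
  rw [Finset.sum_boole]
  congr 2
  ext i
  simp only [Finset.mem_filter, Finset.mem_range]
  constructor
  · rintro ⟨_, h, h'⟩; exact ⟨by omega, h'⟩
  · rintro ⟨h, h'⟩; exact ⟨by omega, by omega, h'⟩

lemma tendsto_occurrences_sub_startFreq [DecidableEq Ω] (ω : ℕ → Ω) (v : Fin ℓ → Ω) :
    Tendsto (fun n : ℕ => (occurrences ω n v : ℝ) / n - startFreq ω n v) atTop (𝓝 0) := by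
  simp only [startFreq, ← sub_div, occurrences_eq_sum]
  exact tendsto_div_natCast_of_abs_le fun n =>
    abs_sum_range_sub_le (c := ℓ + 1) (abs_occursAt_le_one ω v) (by omega) (by omega)

lemma history_add (ω : ℕ → Ω) (i m : ℕ) :
    history ω (i + m) = history ω i ++ List.ofFn (fun j : Fin m => ω (i + j)) := by
  simp [history, List.ofFn_add]

lemma history_succ (ω : ℕ → Ω) (n : ℕ) : history ω (n + 1) = history ω n ++ [ω n] := by
  simp [history_add]

lemma length_history (ω : ℕ → Ω) (n : ℕ) : (history ω n).length = n := by
  simp [history]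

/-- An occurrence of `v` at `i` is seen by the history of length `i + ℓ`; since `k ≤ ℓ`, the
forecast made there is determined by the last `k` letters of `v`. -/
lemma excess_history_add [Fintype Ω] [DecidableEq Ω] {M : Ω → (Fin k → Ω) → ℝ} {p : List Ω → Ω → ℝ}
    (hp : FollowsKernel M p) (ω : ℕ → Ω) (hk : k ≤ ℓ) (v : Fin ℓ → Ω) (a : Ω) (i : ℕ) :
    excess p (List.ofFn v) a (history ω (i + ℓ)) (ω (i + ℓ)) =
      occursAt ω (Fin.snoc v a : Fin (ℓ + 1) → Ω) i -
        M a (fun j => v ⟨ℓ - k + j, by omega⟩) * occursAt ω v i := by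
  have hsuf : List.ofFn v <:+ history ω (i + ℓ) ↔ ∀ j : Fin ℓ, ω (i + j) = v j := by
    rw [history_add]
    constructor
    · intro h
      have h2 := List.suffix_of_suffix_length_le h (List.suffix_append (history ω i) _) (by simp)
      have h3 := List.ofFn_injective (h2.eq_of_length (by simp))
      exact fun j => (congrFun h3 j).symm
    · intro h
      rw [show (fun j : Fin ℓ => ω (i + j)) = v from funext h]
      exact List.suffix_append _ _
  have hsnoc : (∀ j : Fin (ℓ + 1), ω (i + j) = (Fin.snoc v a : Fin (ℓ + 1) → Ω) j) ↔
      (∀ j : Fin ℓ, ω (i + j) = v j) ∧ ω (i + ℓ) = a := by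
    rw [Fin.forall_fin_succ']
    simp
  unfold excess occursAt
  simp only [hsuf, hsnoc]
  by_cases h : ∀ j : Fin ℓ, ω (i + j) = v j
  · have hpM : p (history ω (i + ℓ)) a = M a (fun j => v ⟨ℓ - k + j, by omega⟩) := by
      rw [show i + ℓ = i + (ℓ - k) + k by omega, history_add, hp.2]
      congr 1
      ext j
      rw [← h]
      congr 1
      simp; omega
    rw [hpM]
    by_cases h' : ω (i + ℓ) = a <;> simp [h, h']
  · simp [h]

lemma tendsto_startFreq_snoc [Fintype Ω] [DecidableEq Ω] {M : Ω → (Fin k → Ω) → ℝ}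
    {p : List Ω → Ω → ℝ} (hp : FollowsKernel M p) {ω : ℕ → Ω} (hk : k ≤ ℓ) (v : Fin ℓ → Ω) (a : Ω)
    (h : Tendsto (fun n : ℕ => (∑ i ∈ Finset.range n,
      excess p (List.ofFn v) a (history ω i) (ω i)) / n) atTop (𝓝 0)) :
    Tendsto (fun n : ℕ => startFreq ω n (Fin.snoc v a : Fin (ℓ + 1) → Ω) -
      M a (fun j => v ⟨ℓ - k + j, by omega⟩) * startFreq ω n v) atTop (𝓝 0) := by
  set X : ℕ → ℝ := fun i => excess p (List.ofFn v) a (history ω i) (ω i)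
  have hX : ∀ i, |X i| ≤ 1 := fun i => abs_excess_le_one hp.1 _ _ _ _
  have h1 : Tendsto (fun n : ℕ => (∑ i ∈ Finset.range (n + ℓ), X i -
      ∑ i ∈ Finset.range n, X i) / n) atTop (𝓝 0) :=
    tendsto_div_natCast_of_abs_le fun n =>
      abs_sum_range_sub_le (c := ℓ) hX (by omega) (by omega)
  have h2 : Tendsto (fun n : ℕ => (∑ i ∈ Finset.range ℓ, X i) / n) atTop (𝓝 0) :=
    tendsto_const_div_atTop_nhds_zero_nat _
  have h3 := (h.add h1).sub h2
  simp only [add_zero, sub_zero] at h3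
  refine h3.congr fun n => ?_
  rw [← add_div, ← sub_div, add_sub_cancel, add_comm n ℓ, Finset.sum_range_add, add_sub_cancel_left,
    startFreq, startFreq, ← mul_div_assoc, ← sub_div, Finset.mul_sum, ← Finset.sum_sub_distrib]
  congr 1
  refine Finset.sum_congr rfl fun i _ => ?_
  rw [← excess_history_add hp ω hk v a i, add_comm ℓ i]

lemma sum_occursAt [Fintype Ω] [DecidableEq Ω] (ω : ℕ → Ω) (i : ℕ) :
    ∑ v : Fin ℓ → Ω, occursAt ω v i = 1 := by
  simp [occursAt, ← funext_iff (f := fun j : Fin ℓ => ω (i + j))]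

lemma sum_occursAt_cons [Fintype Ω] [DecidableEq Ω] (ω : ℕ → Ω) (v : Fin ℓ → Ω) (i : ℕ) :
    ∑ c : Ω, occursAt ω (Fin.cons c v : Fin (ℓ + 1) → Ω) i = occursAt ω v (i + 1) := by
  have h : ∀ c, (∀ j : Fin (ℓ + 1), ω (i + j) = (Fin.cons c v : Fin (ℓ + 1) → Ω) j) ↔
      ω i = c ∧ ∀ j : Fin ℓ, ω (i + 1 + j) = v j := fun c => by
    rw [Fin.forall_fin_succ]
    simp [add_comm, add_left_comm]
  simp only [occursAt, h]
  by_cases h' : ∀ j : Fin ℓ, ω (i + 1 + j) = v j <;> simp [h']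

/-- Extending `v` to the left only shifts the starting position by one, so the sums telescope to a
boundary term. This yields the stationarity equation in the limit. -/
lemma tendsto_startFreq_sub_sum_cons [Fintype Ω] [DecidableEq Ω] (ω : ℕ → Ω) (v : Fin ℓ → Ω) :
    Tendsto (fun n : ℕ => startFreq ω n v -
      ∑ c : Ω, startFreq ω n (Fin.cons c v : Fin (ℓ + 1) → Ω)) atTop (𝓝 0) := by
  simp only [startFreq, ← Finset.sum_div, ← sub_div]
  refine tendsto_div_natCast_of_abs_le (c := 1) fun n => ?_
  rw [Finset.sum_comm]
  simp only [sum_occursAt_cons]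
  rw [← Finset.sum_sub_distrib, Finset.sum_range_sub' (occursAt ω v), abs_le]
  have h0 := occursAt_nonneg ω v
  have h1 := occursAt_le_one ω v
  constructor <;> linarith [h0 0, h1 0, h0 n, h1 n]

lemma sum_startFreq [Fintype Ω] [DecidableEq Ω] (ω : ℕ → Ω) {n : ℕ} (hn : n ≠ 0) :
    ∑ v : Fin ℓ → Ω, startFreq ω n v = 1 := by
  simp only [startFreq, ← Finset.sum_div]
  rw [Finset.sum_comm]
  simp only [sum_occursAt]
  simp [hn]

lemma startFreq_mem_Icc [DecidableEq Ω] (ω : ℕ → Ω) (n : ℕ) (v : Fin ℓ → Ω) :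
    startFreq ω n v ∈ Set.Icc (0 : ℝ) 1 := by
  refine ⟨div_nonneg (Finset.sum_nonneg fun i _ => occursAt_nonneg ω v i) n.cast_nonneg, ?_⟩
  refine div_le_one_of_le₀ ((Finset.sum_le_sum fun i _ => occursAt_le_one ω v i).trans ?_)
    n.cast_nonneg
  simp

/-- If the letter frequencies after every word of length `k` agree asymptotically with the kernel,
then the word frequencies converge to the stationary distribution. -/
lemma tendsto_startFreq_stationary [Fintype Ω] [DecidableEq Ω] [Nonempty Ω]
    {M : Ω → (Fin k → Ω) → ℝ} (hM : IsKernel M) {π : (Fin k → Ω) → ℝ}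
    (hπ : IsStationary M π) {ω : ℕ → Ω}
    (h : ∀ (v : Fin k → Ω) (a : Ω),
      Tendsto (fun n : ℕ => startFreq ω n (Fin.snoc v a : Fin (k + 1) → Ω) -
        M a v * startFreq ω n v) atTop (𝓝 0)) (v : Fin k → Ω) :
    Tendsto (fun n : ℕ => startFreq ω n v) atTop (𝓝 (π v)) := by
  suffices H : Tendsto (fun (n : ℕ) (v : Fin k → Ω) => startFreq ω n v) atTop (𝓝 π) from
    tendsto_pi_nhds.1 H v
  have hK : IsCompact (Set.pi Set.univ fun _ : Fin k → Ω => Set.Icc (0 : ℝ) 1) :=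
    isCompact_univ_pi fun _ => isCompact_Icc
  -- The frequency vectors lie in a compact cube, so it suffices that every cluster point is
  -- stationary and hence equal to `π`.
  refine hK.tendsto_nhds_of_unique_mapClusterPt
    (Eventually.of_forall fun n v _ => startFreq_mem_Icc ω n v) fun y hy hcl => ?_
  have hlim : ∀ (G : ((Fin k → Ω) → ℝ) → ℝ) (r : ℝ), Continuous G →
      Tendsto (fun n : ℕ => G fun v => startFreq ω n v) atTop (𝓝 r) → G y = r := by
    intro G r hG hr
    have h1 : MapClusterPt (G y) atTop (G ∘ fun (n : ℕ) (v : Fin k → Ω) => startFreq ω n v) :=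
      hcl.continuousAt_comp hG.continuousAt
    exact eq_of_nhds_neBot (h1.clusterPt.mono hr)
  refine hπ.unique hM ⟨fun v => (hy v trivial).1, ?_, fun v => ?_⟩
  · refine hlim (fun y => ∑ v, y v) 1 (by fun_prop) (tendsto_const_nhds.congr' ?_)
    filter_upwards [eventually_ne_atTop 0] with n hn
    exact (sum_startFreq ω hn).symm
  · rw [← sub_eq_zero]
    refine hlim (fun y => y v - ∑ c : Ω, (fun x : Fin (k + 1) → Ω =>
      M (x (Fin.last k)) (Fin.init x) * y (Fin.init x)) (Fin.cons c v)) 0 (by fun_prop) ?_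
    have h1 := (tendsto_startFreq_sub_sum_cons ω v).add (tendsto_finsetSum Finset.univ
      fun c _ => h (Fin.init (Fin.cons c v : Fin (k + 1) → Ω))
        ((Fin.cons c v : Fin (k + 1) → Ω) (Fin.last k)))
    simp only [Fin.snoc_init_self, Finset.sum_const_zero, add_zero] at h1
    refine h1.congr fun n => ?_
    rw [Finset.sum_sub_distrib]
    ring

lemma jointProb_snoc (M : Ω → (Fin k → Ω) → ℝ) (π : (Fin k → Ω) → ℝ) (hk : k ≤ ℓ)
    (v : Fin ℓ → Ω) (a : Ω) :
    jointProb M π (hk.trans ℓ.le_succ) (Fin.snoc v a : Fin (ℓ + 1) → Ω) =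
      M a (fun j => v ⟨ℓ - k + j, by omega⟩) * jointProb M π hk v := by
  obtain ⟨m, rfl⟩ := Nat.exists_eq_add_of_le hk
  have hs : ∀ (i : ℕ) (hi : i < k + m),
      (Fin.snoc v a : Fin (k + m + 1) → Ω) ⟨i, by omega⟩ = v ⟨i, hi⟩ := fun i hi =>
    Fin.snoc_castSucc (α := fun _ => Ω) a v ⟨i, hi⟩
  have hlast : (Fin.snoc v a : Fin (k + m + 1) → Ω) ⟨k + m, by omega⟩ = a :=
    Fin.snoc_last (α := fun _ => Ω) a v
  unfold jointProb
  rw [← Fin.prod_congr' _ (show m + 1 = k + m + 1 - k by omega),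
    ← Fin.prod_congr' _ (show m = k + m - k by omega), Fin.prod_univ_castSucc, mul_comm (M a _),
    mul_assoc]
  congr 1
  · congr 1
    ext j
    exact hs j (by omega)
  · congr 1
    · refine Finset.prod_congr rfl fun i _ => ?_
      simp only [Fin.val_cast, Fin.val_castSucc]
      rw [hs _ (by omega)]
      congr 1
      ext j
      exact hs _ (by omega)
    · simp only [Fin.val_cast, Fin.val_last]
      congr 1
      · rw [← hlast]
        congr 2
        omega
      · ext j
        rw [hs _ (by omega)]
        congr 2
        omega

/-- Length `k` is settled by uniqueness of `π`; longer words follow by induction, each new letter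
multiplying the limit by its kernel value. -/
lemma isNormal_of_tendsto_excess [Fintype Ω] [DecidableEq Ω] [Nonempty Ω]
    {M : Ω → (Fin k → Ω) → ℝ} (hM : IsKernel M) {π : (Fin k → Ω) → ℝ}
    (hπ : IsStationary M π) {p : List Ω → Ω → ℝ} (hp : FollowsKernel M p)
    {ω : ℕ → Ω} (h : ∀ v : List Ω, k ≤ v.length → ∀ a, Tendsto (fun n : ℕ =>
      (∑ i ∈ Finset.range n, excess p v a (history ω i) (ω i)) / n) atTop (𝓝 0)) :
    IsNormal M π ω := by
  have hsnoc : ∀ (ℓ : ℕ) (hk : k ≤ ℓ) (v : Fin ℓ → Ω) (a : Ω), _ := fun ℓ hk v a =>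
    tendsto_startFreq_snoc hp hk v a (h (List.ofFn v) (by simpa using hk) a)
  have hfreq : ∀ (ℓ : ℕ) (hk : k ≤ ℓ) (v : Fin ℓ → Ω),
      Tendsto (fun n => startFreq ω n v) atTop (𝓝 (jointProb M π hk v)) := by
    intro ℓ hk
    induction ℓ, hk using Nat.le_induction with
    | base =>
      intro v
      have := tendsto_startFreq_stationary hM hπ (ω := ω) (fun v a => by
        simpa using hsnoc k le_rfl v a) v
      rwa [jointProb, Finset.prod_eq_one fun i _ => absurd i.2 (by omega), mul_one]
    | succ ℓ hk ih =>
      intro v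
      rw [← Fin.snoc_init_self v, jointProb_snoc M π hk]
      simpa using (hsnoc ℓ hk (Fin.init v) (v (Fin.last ℓ))).add ((ih (Fin.init v)).const_mul
        (M (v (Fin.last ℓ)) fun j => Fin.init v ⟨ℓ - k + j, by omega⟩))
  intro ℓ hk v
  simpa using (tendsto_occurrences_sub_startFreq ω v).add (hfreq ℓ hk v)

end Frequencies

/-! ### Sequential weights of words. -/

section WordProb

variable {Ω : Type*}

/-- The product of the conditional probabilities `q` of the letters of a word following a given
history. -/
noncomputable def wordProb (q : List Ω → Ω → ℝ) : List Ω → List Ω → ℝ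
  | _, [] => 1
  | w, b :: y => q w b * wordProb q (w ++ [b]) y

lemma wordProb_append (q : List Ω → Ω → ℝ) (w y z : List Ω) :
    wordProb q w (y ++ z) = wordProb q w y * wordProb q (w ++ y) z := by
  induction y generalizing w with
  | nil => simp [wordProb]
  | cons b y ih => simp [wordProb, ih, mul_assoc]

lemma wordProb_append_singleton (q : List Ω → Ω → ℝ) (w : List Ω) (b : Ω) :
    wordProb q [] (w ++ [b]) = wordProb q [] w * q w b := by
  simp [wordProb_append, wordProb]

lemma wordProb_nonneg {q : List Ω → Ω → ℝ} (hq : ∀ w b, 0 ≤ q w b) (w y : List Ω) :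
    0 ≤ wordProb q w y := by
  induction y generalizing w with
  | nil => simp [wordProb]
  | cons b y ih => exact mul_nonneg (hq w b) (ih _)

lemma wordProb_pos {q : List Ω → Ω → ℝ} (hq : ∀ w b, 0 < q w b) (w y : List Ω) :
    0 < wordProb q w y := by
  induction y generalizing w with
  | nil => simp [wordProb]
  | cons b y ih => exact mul_pos (hq w b) (ih _)

lemma wordProb_le_one {q : List Ω → Ω → ℝ} (hq : ∀ w b, 0 ≤ q w b) (hq' : ∀ w b, q w b ≤ 1)
    (w y : List Ω) : wordProb q w y ≤ 1 := by
  induction y generalizing w with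
  | nil => simp [wordProb]
  | cons b y ih => exact mul_le_one₀ (hq' w b) (wordProb_nonneg hq _ _) (ih _)

lemma wordProb_history (q : List Ω → Ω → ℝ) (ω : ℕ → Ω) (n : ℕ) :
    wordProb q [] (history ω n) = ∏ i ∈ Finset.range n, q (history ω i) (ω i) := by
  induction n with
  | zero => simp [history, wordProb]
  | succ n ih => rw [history_succ, wordProb_append_singleton, ih, Finset.prod_range_succ]

/-- The words of length at most `m`. -/
def wordsUpTo (Ω : Type*) [Fintype Ω] [DecidableEq Ω] : ℕ → Finset (List Ω)
  | 0 => {[]}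
  | m + 1 => insert [] ((Finset.univ ×ˢ wordsUpTo Ω m).image fun z => z.1 :: z.2)

lemma mem_wordsUpTo [Fintype Ω] [DecidableEq Ω] {m : ℕ} {y : List Ω} (h : y.length ≤ m) :
    y ∈ wordsUpTo Ω m := by
  induction m generalizing y with
  | zero => simpa [wordsUpTo] using h
  | succ m ih =>
    cases y with
    | nil => simp [wordsUpTo]
    | cons b y =>
      simpa [wordsUpTo] using ih (by simpa using h)

/-- The words of each length `m` have total weight at most `t ^ m`; the bound is the geometric
series. -/
lemma sum_wordProb_le [Fintype Ω] [DecidableEq Ω] {q : List Ω → Ω → ℝ} {t : ℝ} (ht : t < 1)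
    (hq : ∀ w b, 0 ≤ q w b) (hsum : ∀ w, ∑ b, q w b ≤ t) (F : Finset (List Ω)) (w : List Ω) :
    ∑ y ∈ F, wordProb q w y ≤ (1 - t)⁻¹ := by
  have ht' : 0 < 1 - t := by linarith
  have hall : ∀ (m : ℕ) (w : List Ω), ∑ y ∈ wordsUpTo Ω m, wordProb q w y ≤ (1 - t)⁻¹ := by
    intro m
    have h0 : 0 ≤ t := (Finset.sum_nonneg fun b _ => hq [] b).trans (hsum [])
    induction m with
    | zero =>
      intro w
      simpa [wordsUpTo, wordProb] using (one_le_inv₀ ht').2 (by linarith)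
    | succ m ih =>
      intro w
      rw [wordsUpTo, Finset.sum_insert (by simp), Finset.sum_image (by
        rintro ⟨a, y⟩ _ ⟨b, z⟩ _ h; simpa using h), Finset.sum_product]
      have h1 : ∀ b, ∑ y ∈ wordsUpTo Ω m, wordProb q w (b :: y) ≤ q w b * (1 - t)⁻¹ := fun b => by
        simp only [wordProb, ← Finset.mul_sum]
        exact mul_le_mul_of_nonneg_left (ih _) (hq w b)
      have h2 : ∑ b, ∑ y ∈ wordsUpTo Ω m, wordProb q w (b :: y) ≤ t * (1 - t)⁻¹ := by
        refine (Finset.sum_le_sum fun b _ => h1 b).trans ?_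
        rw [← Finset.sum_mul]
        exact mul_le_mul_of_nonneg_right (hsum w) (inv_nonneg.2 ht'.le)
      refine (add_le_add_right h2 _).trans_eq ?_
      simp only [wordProb]
      field_simp
      ring
  refine (Finset.sum_le_sum_of_subset_of_nonneg (fun y hy => mem_wordsUpTo
    (Finset.le_sup (f := List.length) hy)) fun y _ _ => wordProb_nonneg hq w y).trans
    (hall (F.sup List.length) w)

/-- The left side is the squarefree term of the multinomial expansion. The induction keeps only the
term linear in the new `g i`. -/
lemma factorial_card_mul_prod_le {ι : Type*} (F : Finset ι) {g : ι → ℝ} (hg : ∀ i, 0 ≤ g i) :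
    (F.card.factorial : ℝ) * ∏ i ∈ F, g i ≤ (∑ i ∈ F, g i) ^ F.card := by
  classical
  induction F using Finset.induction_on with
  | empty => simp
  | insert i F hi ih =>
    rw [Finset.prod_insert hi, Finset.sum_insert hi, Finset.card_insert_of_notMem hi]
    have hS : 0 ≤ ∑ i ∈ F, g i := Finset.sum_nonneg fun i _ => hg i
    have hb : ((F.card + 1 : ℕ) : ℝ) * g i * (∑ i ∈ F, g i) ^ F.card ≤
        (g i + ∑ i ∈ F, g i) ^ (F.card + 1) := by
      rw [add_pow]
      refine le_trans (le_of_eq ?_) (Finset.single_le_sum (f := fun m =>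
        g i ^ m * (∑ i ∈ F, g i) ^ (F.card + 1 - m) * ((F.card + 1).choose m : ℝ))
        (fun m _ => mul_nonneg (mul_nonneg (pow_nonneg (hg i) _) (pow_nonneg hS _))
          (Nat.cast_nonneg _)) (Finset.mem_range.2 (by omega : 1 < F.card + 1 + 1)))
      simp
      ring
    refine le_trans (le_of_eq ?_) ((mul_le_mul_of_nonneg_left ih
      (mul_nonneg (Nat.cast_nonneg (F.card + 1)) (hg i))).trans hb)
    rw [Nat.factorial_succ]
    push_cast
    ring

lemma wordProb_state {q : List Ω → Ω → ℝ} {σ : List Ω → List Ω}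
    (hσ : ∀ w y b, q (w ++ y) b = q (σ w ++ y) b) (w y : List Ω) :
    wordProb q w y = wordProb q (σ w) y := by
  suffices H : ∀ z, wordProb q (w ++ z) y = wordProb q (σ w ++ z) y by simpa using H []
  induction y with
  | nil => simp [wordProb]
  | cons b y ih =>
    intro z
    rw [wordProb, wordProb, hσ w z b, List.append_assoc, List.append_assoc, ih]

end WordProb

/-! ### Lempel–Ziv probabilities and their domination of finite-memory weights. -/

section LempelZiv

variable {Ω : Type*} [DecidableEq Ω]

lemma parse_append_singleton (w : List Ω) (x : Ω) : parse (w ++ [x]) = (parse w).step x := by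
  simp [parse]

lemma parse_current_mem (w : List Ω) : (parse w).current ∈ insert [] (parse w).phrases := by
  induction w using List.reverseRecOn with
  | nil => simp [parse]
  | append_singleton w x ih =>
    rw [parse_append_singleton, Parse.step]
    split_ifs with h
    · exact Finset.mem_insert_of_mem h
    · simp

lemma length_eq_sum_phrases (w : List Ω) :
    w.length = ∑ y ∈ (parse w).phrases, y.length + (parse w).current.length := by
  induction w using List.reverseRecOn with
  | nil => simp [parse]
  | append_singleton w x ih =>
    rw [parse_append_singleton, Parse.step]
    split_ifs with h
    · simp [ih, add_assoc]
    · simp [ih, Finset.sum_insert h]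
      ring

/-- Phrases are distinct, so a finite-state `q` assigns to a word at most the product over its
phrases of the total `q`-weight of the phrase over all states. -/
lemma exists_wordProb_le_prod_phrases {q : List Ω → Ω → ℝ} (hq : ∀ w b, 0 ≤ q w b)
    {S : Finset (List Ω)} {σ : List Ω → List Ω} (hσS : ∀ w, σ w ∈ S)
    (hσ : ∀ w y b, q (w ++ y) b = q (σ w ++ y) b) (w : List Ω) :
    ∃ w₀, w = w₀ ++ (parse w).current ∧
      wordProb q [] w₀ ≤ ∏ y ∈ (parse w).phrases, ∑ s ∈ S, wordProb q s y := by
  induction w using List.reverseRecOn with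
  | nil => exact ⟨[], by simp [parse, wordProb]⟩
  | append_singleton w x ih =>
    obtain ⟨w₀, hw, hle⟩ := ih
    rw [parse_append_singleton, Parse.step]
    have hw' : w ++ [x] = w₀ ++ ((parse w).current ++ [x]) := by
      rw [← List.append_assoc, ← hw]
    split_ifs with h
    · exact ⟨w₀, hw', hle⟩
    · refine ⟨w ++ [x], by simp, ?_⟩
      rw [Finset.prod_insert h, hw', wordProb_append, mul_comm]
      refine mul_le_mul ?_ hle (wordProb_nonneg hq _ _)
        (Finset.sum_nonneg fun s _ => wordProb_nonneg hq _ _)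
      rw [List.nil_append, wordProb_state hσ]
      -- The state in which the phrase started is one of those summed over.
      exact Finset.single_le_sum (fun s _ => wordProb_nonneg hq s _) (hσS w₀)

variable [Fintype Ω]

lemma Parse.mem_candidates {s : Parse Ω} {ξ : List Ω} :
    ξ ∈ s.candidates ↔
      (∃ u ∈ insert [] s.phrases, ∃ b, u ++ [b] = ξ) ∧ ξ ∉ insert [] s.phrases := by
  simp only [Parse.candidates, Finset.mem_sdiff, Finset.mem_image, Finset.mem_product,
    Finset.mem_univ, and_true, Prod.exists]
  refine and_congr_left fun _ => ⟨?_, ?_⟩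
  · rintro ⟨u, b, hu, h⟩; exact ⟨u, hu, b, h⟩
  · rintro ⟨u, hu, b, h⟩; exact ⟨u, b, hu, h⟩

lemma Parse.card_candidates_le (s : Parse Ω) :
    s.candidates.card ≤ Fintype.card Ω * (s.phrases.card + 1) := by
  refine (Finset.card_le_card Finset.sdiff_subset).trans (Finset.card_image_le.trans ?_)
  rw [Finset.card_product, mul_comm, Finset.card_univ]
  exact Nat.mul_le_mul_left _ (Finset.card_insert_le _ _)

/-- The number of candidates for the next phrase that extend `ξ`. -/
def Parse.extensions (s : Parse Ω) (ξ : List Ω) : ℕ :=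
  (s.candidates.filter (fun η => ξ <+: η)).card

lemma lzProb_eq (w : List Ω) (a : Ω) :
    lzProb w a = ((parse w).extensions ((parse w).current ++ [a]) : ℝ) /
      ((parse w).extensions (parse w).current : ℝ) := rfl

lemma Parse.extensions_nil (s : Parse Ω) : s.extensions [] = s.candidates.card := by
  simp [Parse.extensions]

lemma Parse.extensions_pos [Nonempty Ω] (s : Parse Ω) {ξ : List Ω}
    (h : ξ ∈ insert [] s.phrases ∪ s.candidates) : 0 < s.extensions ξ := by
  rw [Parse.extensions, Finset.card_pos]
  rcases Finset.mem_union.1 h with h | h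
  -- A longest phrase extending `ξ` has only candidates as one-letter extensions.
  · obtain ⟨u, hu, hmax⟩ := Finset.exists_max_image
      ((insert [] s.phrases).filter (fun η => ξ <+: η)) List.length
      ⟨ξ, Finset.mem_filter.2 ⟨h, List.prefix_refl ξ⟩⟩
    rw [Finset.mem_filter] at hu
    obtain ⟨b⟩ := ‹Nonempty Ω›
    have hpre : ξ <+: u ++ [b] := hu.2.trans (List.prefix_append u [b])
    refine ⟨u ++ [b], Finset.mem_filter.2 ⟨Parse.mem_candidates.2 ⟨⟨u, hu.1, b, rfl⟩, ?_⟩, hpre⟩⟩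
    intro hmem
    have := hmax (u ++ [b]) (Finset.mem_filter.2 ⟨hmem, hpre⟩)
    simp at this
  · exact ⟨ξ, Finset.mem_filter.2 ⟨h, List.prefix_refl ξ⟩⟩

lemma extensions_current_pos [Nonempty Ω] (w : List Ω) :
    0 < (parse w).extensions (parse w).current :=
  (parse w).extensions_pos (Finset.mem_union_left _ (parse_current_mem w))

lemma extensions_current_append_pos [Nonempty Ω] (w : List Ω) (a : Ω) :
    0 < (parse w).extensions ((parse w).current ++ [a]) := by
  refine (parse w).extensions_pos ?_
  rw [Finset.mem_union]
  by_cases h : (parse w).current ++ [a] ∈ insert [] (parse w).phrases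
  · exact Or.inl h
  · exact Or.inr (Parse.mem_candidates.2 ⟨⟨_, parse_current_mem w, a, rfl⟩, h⟩)

lemma Parse.sum_extensions (s : Parse Ω) {ξ : List Ω} (h : ξ ∈ insert [] s.phrases) :
    ∑ a, s.extensions (ξ ++ [a]) = s.extensions ξ := by
  simp only [Parse.extensions, Finset.card_filter]
  rw [Finset.sum_comm]
  refine Finset.sum_congr rfl fun η hη => ?_
  by_cases hpre : ξ <+: η
  · obtain ⟨t, rfl⟩ := hpre
    cases t with
    | nil =>
      rw [List.append_nil] at hη
      exact absurd h (Parse.mem_candidates.1 hη).2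
    | cons c t => simp [List.prefix_append_right_inj]
  · rw [if_neg hpre]
    exact Finset.sum_eq_zero fun a _ => if_neg fun h' =>
      hpre ((List.prefix_append ξ [a]).trans h')

lemma isForecast_lzProb [Nonempty Ω] (w : List Ω) : IsForecast (lzProb w) := by
  have h0 : (0 : ℝ) < (parse w).extensions (parse w).current := by
    exact_mod_cast extensions_current_pos w
  constructor
  · intro a
    rw [lzProb_eq]
    exact div_pos (by exact_mod_cast extensions_current_append_pos w a) h0
  · simp only [lzProb_eq, ← Finset.sum_div]
    rw [div_eq_one_iff_eq h0.ne']
    exact_mod_cast (parse w).sum_extensions (parse_current_mem w)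

/-- Within a phrase the factors of `lzProb` telescope to a quotient of extension counts, starting
from the number of all candidates. When a phrase closes, the old count is at least `1` and there
were at most `A * (c + 1)` candidates, which supplies the next factor of `A ^ c * c!`. -/
lemma extensions_current_le [Nonempty Ω] (w : List Ω) :
    ((parse w).extensions (parse w).current : ℝ) ≤
      wordProb lzProb [] w * ((parse w).candidates.card *
        ((Fintype.card Ω : ℝ) ^ (parse w).phrases.card * (parse w).phrases.card.factorial)) := by
  induction w using List.reverseRecOn with
  | nil => simp [parse, wordProb, Parse.extensions_nil]
  | append_singleton w x ih =>
    have h0 : (0 : ℝ) < (parse w).extensions (parse w).current := by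
      exact_mod_cast extensions_current_pos w
    have hstep : ((parse w).extensions ((parse w).current ++ [x]) : ℝ) ≤
        wordProb lzProb [] (w ++ [x]) * ((parse w).candidates.card *
        ((Fintype.card Ω : ℝ) ^ (parse w).phrases.card * (parse w).phrases.card.factorial)) := by
      rw [wordProb_append_singleton, lzProb_eq, mul_right_comm, mul_div_assoc', le_div_iff₀ h0,
        mul_comm]
      exact mul_le_mul_of_nonneg_right ih (Nat.cast_nonneg _)
    have h1 : (1 : ℝ) ≤ (parse w).extensions ((parse w).current ++ [x]) := by
      exact_mod_cast extensions_current_append_pos w x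
    rw [parse_append_singleton, Parse.step]
    split_ifs with h
    · exact hstep
    · rw [Parse.extensions_nil, Finset.card_insert_of_notMem h, Nat.factorial_succ]
      set V := Parse.candidates ⟨insert ((parse w).current ++ [x]) (parse w).phrases, []⟩
      set c := (parse w).phrases.card
      have hpos := wordProb_pos (fun w b => (isForecast_lzProb (Ω := Ω) w).1 b) [] (w ++ [x])
      have hV : ((parse w).candidates.card : ℝ) ≤ (Fintype.card Ω : ℝ) * (c + 1) := by
        exact_mod_cast (parse w).card_candidates_le
      have h2 : 1 ≤ wordProb lzProb [] (w ++ [x]) *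
          ((Fintype.card Ω : ℝ) ^ (c + 1) * ((c + 1) * c.factorial)) := by
        refine (h1.trans hstep).trans ?_
        refine mul_le_mul_of_nonneg_left ?_ hpos.le
        refine (mul_le_mul_of_nonneg_right hV (by positivity)).trans_eq ?_
        ring
      push_cast
      calc (V.card : ℝ) = V.card * 1 := by ring
        _ ≤ V.card * _ := mul_le_mul_of_nonneg_left h2 (Nat.cast_nonneg _)
        _ = _ := by ring

lemma one_le_wordProb_lzProb [Nonempty Ω] (w : List Ω) :
    1 ≤ wordProb lzProb [] w * ((Fintype.card Ω : ℝ) ^ ((parse w).phrases.card + 1) *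
      (((parse w).phrases.card + 1) * (parse w).phrases.card.factorial)) := by
  have h1 : (1 : ℝ) ≤ (parse w).extensions (parse w).current := by
    exact_mod_cast extensions_current_pos w
  have hV : ((parse w).candidates.card : ℝ) ≤
      (Fintype.card Ω : ℝ) * ((parse w).phrases.card + 1) := by
    exact_mod_cast (parse w).card_candidates_le
  refine (h1.trans (extensions_current_le w)).trans (mul_le_mul_of_nonneg_left ?_
    (wordProb_pos (fun w b => (isForecast_lzProb (Ω := Ω) w).1 b) [] w).le)
  refine (mul_le_mul_of_nonneg_right hV (by positivity)).trans_eq ?_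
  ring

/-- Phrases outside `wordsUpTo Ω m` use up at least `m` letters each, and there are boundedly many
others. -/
lemma mul_card_phrases_le (w : List Ω) (m : ℕ) :
    m * (parse w).phrases.card ≤ w.length + m * (wordsUpTo Ω m).card := by
  have h1 : ∑ _y ∈ (parse w).phrases \ wordsUpTo Ω m, m ≤
      ∑ y ∈ (parse w).phrases \ wordsUpTo Ω m, y.length := by
    refine Finset.sum_le_sum fun y hy => ?_
    by_contra hlt
    exact (Finset.mem_sdiff.1 hy).2 (mem_wordsUpTo (by omega))
  have h2 : ∑ y ∈ (parse w).phrases \ wordsUpTo Ω m, y.length ≤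
      ∑ y ∈ (parse w).phrases, y.length :=
    Finset.sum_le_sum_of_subset Finset.sdiff_subset
  have h3 := length_eq_sum_phrases w
  have h4 : (parse w).phrases.card ≤
      ((parse w).phrases \ wordsUpTo Ω m).card + (wordsUpTo Ω m).card :=
    tsub_le_iff_right.1 (Finset.le_card_sdiff _ _)
  rw [Finset.sum_const, smul_eq_mul, mul_comm] at h1
  nlinarith [Nat.mul_le_mul_left m h4]

/-- The number of phrases is sublinear in the length of the word. -/
lemma eventually_card_phrases_le (ω : ℕ → Ω) {ε : ℝ} (hε : 0 < ε) :
    ∀ᶠ n : ℕ in atTop, ((parse (history ω n)).phrases.card : ℝ) ≤ ε * n := by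
  -- For large `n` the additive constant is at most `n`, so the phrase count is at most `2 * n / m`.
  obtain ⟨m, hm⟩ := exists_nat_gt (2 / ε)
  have hm0 : (0 : ℝ) < m := lt_trans (by positivity) hm
  filter_upwards [tendsto_natCast_atTop_atTop.eventually_ge_atTop
    (m * (wordsUpTo Ω m).card : ℝ)] with n hn
  have h := mul_card_phrases_le (history ω n) m
  rw [length_history] at h
  have h' : (m : ℝ) * (parse (history ω n)).phrases.card ≤ n + m * (wordsUpTo Ω m).card := by
    exact_mod_cast h
  have h2 : 2 < m * ε := (div_lt_iff₀ hε).1 hm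
  refine le_of_mul_le_mul_left ?_ hm0
  nlinarith [Nat.cast_nonneg (α := ℝ) n]

lemma wordProb_le_wordProb_lzProb [Nonempty Ω] {q : List Ω → Ω → ℝ} {t : ℝ} (ht : t < 1)
    (hq : ∀ w b, 0 ≤ q w b) (hsum : ∀ w, ∑ b, q w b ≤ t) {S : Finset (List Ω)}
    {σ : List Ω → List Ω} (hσS : ∀ w, σ w ∈ S) (hσ : ∀ w y b, q (w ++ y) b = q (σ w ++ y) b)
    (w : List Ω) :
    wordProb q [] w ≤ Fintype.card Ω *
      (2 * Fintype.card Ω * (S.card * (1 - t)⁻¹)) ^ (parse w).phrases.card *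
        wordProb lzProb [] w := by
  have hq1 : ∀ w b, q w b ≤ 1 := fun w b =>
    (Finset.single_le_sum (fun b _ => hq w b) (Finset.mem_univ b)).trans ((hsum w).trans ht.le)
  obtain ⟨w₀, hw, hle⟩ := exists_wordProb_le_prod_phrases hq hσS hσ w
  have h1 : wordProb q [] w ≤ ∏ y ∈ (parse w).phrases, ∑ s ∈ S, wordProb q s y := by
    conv_lhs => rw [hw, wordProb_append]
    exact (mul_le_of_le_one_right (wordProb_nonneg hq _ _) (wordProb_le_one hq hq1 _ _)).trans hle
  have h2 : ∑ y ∈ (parse w).phrases, ∑ s ∈ S, wordProb q s y ≤ S.card * (1 - t)⁻¹ := by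
    rw [Finset.sum_comm]
    refine (Finset.sum_le_sum fun s _ => sum_wordProb_le ht hq hsum _ s).trans_eq ?_
    simp
  have hg : ∀ y, 0 ≤ ∑ s ∈ S, wordProb q s y := fun y =>
    Finset.sum_nonneg fun s _ => wordProb_nonneg hq s y
  have h3 := (factorial_card_mul_prod_le (parse w).phrases hg).trans
    (pow_le_pow_left₀ (Finset.sum_nonneg fun y _ => hg y) h2 _)
  have h4 := one_le_wordProb_lzProb w
  have hZ := wordProb_pos (fun w b => (isForecast_lzProb (Ω := Ω) w).1 b) [] w
  set c := (parse w).phrases.card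
  set Z := wordProb lzProb [] w
  set A : ℝ := (Fintype.card Ω : ℝ)
  set C : ℝ := (S.card : ℝ) * (1 - t)⁻¹
  have hA : 0 ≤ A := Nat.cast_nonneg _
  have hZA : 0 ≤ Z * A ^ (c + 1) := mul_nonneg hZ.le (pow_nonneg hA _)
  have hP := wordProb_nonneg hq [] w
  have hC : 0 ≤ C := mul_nonneg (Nat.cast_nonneg _) (inv_nonneg.2 (by linarith))
  have h5 : (c.factorial : ℝ) * wordProb q [] w ≤ C ^ c :=
    (mul_le_mul_of_nonneg_left h1 (Nat.cast_nonneg _)).trans h3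
  have h6 : ((c : ℝ) + 1) ≤ 2 ^ c := by
    exact_mod_cast Nat.lt_two_pow_self
  calc wordProb q [] w ≤ wordProb q [] w * (Z * (A ^ (c + 1) * ((c + 1) * c.factorial))) :=
        le_mul_of_one_le_right hP h4
    _ = (c.factorial * wordProb q [] w) * (Z * A ^ (c + 1)) * (c + 1) := by ring
    _ ≤ C ^ c * (Z * A ^ (c + 1)) * 2 ^ c := by
        refine mul_le_mul ?_ h6 (by
          linarith [Nat.cast_nonneg (α := ℝ) c]) (mul_nonneg (pow_nonneg hC _) hZA)
        exact mul_le_mul_of_nonneg_right h5 hZA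
    _ = A * (2 * A * C) ^ c * Z := by rw [mul_pow, mul_pow]; ring

end LempelZiv

/-! ### Tilted forecasts and the growth of the likelihood ratio. -/

section Tilting

variable {Ω : Type*} {k : ℕ}

lemma wordProb_const_mul (t : ℝ) (q : List Ω → Ω → ℝ) (ω : ℕ → Ω) (n : ℕ) :
    wordProb (fun w b => t * q w b) [] (history ω n) = t ^ n * wordProb q [] (history ω n) := by
  simp [wordProb_history, Finset.prod_mul_distrib]

lemma suffix_append_iff_of_length_le {v u z : List Ω} (h : v.length ≤ z.length) :
    v <:+ u ++ z ↔ v <:+ z :=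
  ⟨fun h' => List.suffix_of_suffix_length_le h' (List.suffix_append u z) h,
    fun h' => h'.trans (List.suffix_append u z)⟩

/-- From `log (1 + x) ≥ x / (1 + x)`; the gap to `x - 2 * x ^ 2` has the sign of `1 + 2 * x`. -/
lemma exp_sub_two_mul_sq_le {x : ℝ} (hx : -(1 / 2) ≤ x) : Real.exp (x - 2 * x ^ 2) ≤ 1 + x := by
  have h1 : 0 < 1 + x := by linarith
  rw [← Real.le_log_iff_exp_le h1]
  refine le_trans ?_ (Real.one_sub_inv_le_log_of_pos h1)
  rw [← sub_nonneg]
  have : 1 - (1 + x)⁻¹ - (x - 2 * x ^ 2) = x ^ 2 * (1 + 2 * x) / (1 + x) := by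
    field_simp
    ring
  rw [this]
  have h2 : 0 ≤ 1 + 2 * x := by linarith
  positivity

lemma eq_take_append_ofFn {z : List Ω} (hz : k ≤ z.length) :
    z = z.take (z.length - k) ++
      List.ofFn (fun j : Fin k => z.get ⟨z.length - k + j, by omega⟩) := by
  conv_lhs => rw [← List.take_append_drop (z.length - k) z]
  congr 1
  refine List.ext_get (by simp; omega) fun n h1 h2 => ?_
  simp

lemma FollowsKernel.append [Fintype Ω] {M : Ω → (Fin k → Ω) → ℝ} {p : List Ω → Ω → ℝ}
    (hp : FollowsKernel M p) (u : List Ω) {z : List Ω} (hz : k ≤ z.length) :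
    p (u ++ z) = p z := by
  ext b
  rw [eq_take_append_ofFn hz, ← List.append_assoc, hp.2, hp.2]

variable [Fintype Ω] [DecidableEq Ω]

/-- The forecasts `p`, tilted in favour of (for `0 < ε`) or against (for `ε < 0`) the letter `a`
after the word `v`. -/
noncomputable def tilt (p : List Ω → Ω → ℝ) (v : List Ω) (a : Ω) (ε : ℝ) (w : List Ω) (b : Ω) : ℝ :=
  p w b * (1 + ε * excess p v a w b)

lemma neg_half_le_mul_excess {p : List Ω → Ω → ℝ} (hp : ∀ w, IsForecast (p w)) (v : List Ω)
    (a : Ω) {ε : ℝ} (hε : |ε| ≤ 1 / 2) (w : List Ω) (b : Ω) :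
    -(1 / 2) ≤ ε * excess p v a w b := by
  have h : |ε * excess p v a w b| ≤ 1 / 2 * 1 := by
    rw [abs_mul]
    exact mul_le_mul hε (abs_excess_le_one hp v a w b) (abs_nonneg _) (by norm_num)
  linarith [(abs_le.1 h).1]

lemma sum_tilt {p : List Ω → Ω → ℝ} (hp : ∀ w, IsForecast (p w)) (v : List Ω) (a : Ω) (ε : ℝ)
    (w : List Ω) : ∑ b, tilt p v a ε w b = 1 := by
  have h : ∑ b, p w b * excess p v a w b = 0 := by
    unfold excess
    split_ifs
    · simp only [mul_sub, Finset.sum_sub_distrib, ← Finset.sum_mul, (hp w).2]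
      simp
    · simp
  simp only [tilt, mul_add, mul_one, Finset.sum_add_distrib, (hp w).2]
  simp only [mul_left_comm _ ε, ← Finset.mul_sum, h, mul_zero, add_zero]

lemma FollowsKernel.tilt_append {M : Ω → (Fin k → Ω) → ℝ} {p : List Ω → Ω → ℝ}
    (hp : FollowsKernel M p) {v : List Ω} (hv : k ≤ v.length) (a : Ω) (ε : ℝ) (u : List Ω)
    {z : List Ω} (hz : v.length ≤ z.length) (b : Ω) :
    tilt p v a ε (u ++ z) b = tilt p v a ε z b := by
  simp only [tilt, excess, hp.append u (hv.trans hz), suffix_append_iff_of_length_le hz]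

lemma wordProb_tilt_ge {p : List Ω → Ω → ℝ} (hp : ∀ w, IsForecast (p w)) (v : List Ω) (a : Ω)
    {ε : ℝ} (hε : |ε| ≤ 1 / 2) (ω : ℕ → Ω) (n : ℕ) :
    wordProb p [] (history ω n) * Real.exp (ε * ∑ i ∈ Finset.range n,
      excess p v a (history ω i) (ω i) - 2 * ε ^ 2 * n) ≤
        wordProb (tilt p v a ε) [] (history ω n) := by
  have h1 : Real.exp (ε * ∑ i ∈ Finset.range n, excess p v a (history ω i) (ω i) -
      2 * ε ^ 2 * n) ≤ ∏ i ∈ Finset.range n, (1 + ε * excess p v a (history ω i) (ω i)) := by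
    refine le_trans (Real.exp_le_exp.2 ?_ : _ ≤ Real.exp (∑ i ∈ Finset.range n,
      (ε * excess p v a (history ω i) (ω i) -
        2 * (ε * excess p v a (history ω i) (ω i)) ^ 2))) ?_
    · rw [Finset.sum_sub_distrib, ← Finset.mul_sum]
      refine sub_le_sub_left ?_ _
      refine (Finset.sum_le_sum fun i _ => (?_ : _ ≤ 2 * ε ^ 2)).trans_eq (by simp [mul_comm])
      have := (sq_le_one_iff_abs_le_one _).2 (abs_excess_le_one hp v a (history ω i) (ω i))
      rw [mul_pow]
      nlinarith [sq_nonneg ε]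
    · rw [Real.exp_sum]
      exact Finset.prod_le_prod (fun i _ => (Real.exp_pos _).le) fun i _ =>
        exp_sub_two_mul_sq_le (neg_half_le_mul_excess hp v a hε _ _)
  rw [wordProb_history (tilt p v a ε)]
  simp only [tilt, Finset.prod_mul_distrib, ← wordProb_history]
  exact mul_le_mul_of_nonneg_left h1 (wordProb_pos (fun w b => (hp w).1 b) _ _).le

/-- The Lempel–Ziv probabilities dominate every tilting of the forecasts up to a subexponential
factor. -/
lemma eventually_wordProb_tilt_le [Nonempty Ω] {M : Ω → (Fin k → Ω) → ℝ} {p : List Ω → Ω → ℝ}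
    (hp : FollowsKernel M p) {v : List Ω} (hv : k ≤ v.length) (a : Ω) {ε : ℝ} (hε : |ε| ≤ 1 / 2)
    (ω : ℕ → Ω) {δ : ℝ} (hδ : 0 < δ) :
    ∀ᶠ n : ℕ in atTop, wordProb (tilt p v a ε) [] (history ω n) ≤
      Fintype.card Ω * Real.exp (2 * δ * n) * wordProb lzProb [] (history ω n) := by
  -- Undoing this damping costs one factor `exp (δ * n)`; the other one absorbs `D ^ c`.
  set t := Real.exp (-δ) with ht
  have ht1 : t < 1 := by rw [ht, Real.exp_lt_one_iff]; linarith
  set S := wordsUpTo Ω v.length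
  set D : ℝ := 2 * Fintype.card Ω * (S.card * (1 - t)⁻¹) with hD
  set E := max D 1
  have hE : 0 ≤ Real.log E := Real.log_nonneg (le_max_right _ _)
  have hE0 : 0 < E := lt_of_lt_of_le one_pos (le_max_right _ _)
  have hD0 : 0 ≤ D := by
    have : 0 < 1 - t := by linarith
    positivity
  filter_upwards [eventually_card_phrases_le ω (ε := δ / (Real.log E + 1)) (by positivity)]
    with n hn
  have hmain := wordProb_le_wordProb_lzProb (q := fun w b => t * tilt p v a ε w b) (t := t) ht1
    (fun w b => mul_nonneg (Real.exp_pos _).le (mul_nonneg ((hp.1 w).1 b).le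
      (by linarith [neg_half_le_mul_excess hp.1 v a hε w b])))
    (fun w => by rw [← Finset.mul_sum, sum_tilt hp.1, mul_one])
    -- The state is the last `v.length` letters. A shorter history is its own state, so the
    -- arbitrary initial forecasts are covered too.
    (S := S) (σ := fun w => w.drop (w.length - v.length))
    (fun w => mem_wordsUpTo (by simp; omega))
    (fun w y b => by
      rcases le_total w.length v.length with h | h
      · simp [Nat.sub_eq_zero_of_le h]
      · conv_lhs => rw [← List.take_append_drop (w.length - v.length) w, List.append_assoc,
          hp.tilt_append hv a ε _ (by simp; omega)])
    (history ω n)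
  rw [wordProb_const_mul, ← hD] at hmain
  set c := (parse (history ω n)).phrases.card
  have hZ := wordProb_pos (fun w b => (isForecast_lzProb (Ω := Ω) w).1 b) [] (history ω n)
  have hDc : D ^ c ≤ Real.exp (δ * n) := by
    calc D ^ c ≤ E ^ c := pow_le_pow_left₀ hD0 (le_max_left _ _) _
      _ = Real.exp (c * Real.log E) := by rw [mul_comm, Real.exp_mul, Real.exp_log hE0,
          Real.rpow_natCast]
      _ ≤ Real.exp (δ * n) := by
        rw [Real.exp_le_exp]
        rw [div_mul_eq_mul_div, le_div_iff₀ (by positivity)] at hn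
        nlinarith [Nat.cast_nonneg (α := ℝ) c]
  have htn : t ^ n * Real.exp (δ * n) = 1 := by
    rw [ht, ← Real.exp_nat_mul, ← Real.exp_add, Real.exp_eq_one_iff]
    ring
  calc wordProb (tilt p v a ε) [] (history ω n)
      = t ^ n * wordProb (tilt p v a ε) [] (history ω n) * Real.exp (δ * n) := by
        rw [mul_right_comm, htn, one_mul]
    _ ≤ Fintype.card Ω * Real.exp (δ * n) * wordProb lzProb [] (history ω n) *
        Real.exp (δ * n) := by
        refine mul_le_mul_of_nonneg_right (hmain.trans ?_) (Real.exp_pos _).le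
        refine mul_le_mul_of_nonneg_right ?_ hZ.le
        exact mul_le_mul_of_nonneg_left hDc (Nat.cast_nonneg _)
    _ = _ := by
        rw [show 2 * δ * (n : ℝ) = δ * n + δ * n by ring, Real.exp_add]
        ring

/-- If some letter frequency deviates from the forecasts, then the Lempel–Ziv likelihood ratio is
unbounded. -/
lemma frequently_lt_lzProb_ratio [Nonempty Ω] {M : Ω → (Fin k → Ω) → ℝ} {p : List Ω → Ω → ℝ}
    (hp : FollowsKernel M p) {v : List Ω} (hv : k ≤ v.length) {a : Ω} {ω : ℕ → Ω}
    (h : ¬ Tendsto (fun n : ℕ => (∑ i ∈ Finset.range n,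
      excess p v a (history ω i) (ω i)) / n) atTop (𝓝 0)) (B : ℝ) :
    ∃ᶠ n : ℕ in atTop,
      B < wordProb lzProb [] (history ω n) / wordProb p [] (history ω n) := by
  set X : ℕ → ℝ := fun n => ∑ i ∈ Finset.range n, excess p v a (history ω i) (ω i) with hX
  obtain ⟨η, hη, hη1, s, hs, hfreq⟩ : ∃ η : ℝ, 0 < η ∧ η ≤ 1 ∧ ∃ s : ℝ, |s| = 1 ∧
      ∃ᶠ n : ℕ in atTop, η * n ≤ s * X n := by
    rw [Metric.tendsto_nhds] at h
    push Not at h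
    obtain ⟨η, hη, hf⟩ := h
    refine ⟨min η 1, by positivity, min_le_right _ _, ?_⟩
    have hor : ∃ᶠ n : ℕ in atTop, min η 1 * n ≤ 1 * X n ∨ min η 1 * n ≤ -1 * X n := by
      refine hf.mono fun n hn => ?_
      have hn0 : (0 : ℝ) < n := by
        rcases Nat.eq_zero_or_pos n with rfl | h0
        · simp at hn; linarith
        · exact_mod_cast h0
      rw [Real.dist_eq, sub_zero, abs_div, Nat.abs_cast, le_div_iff₀ hn0] at hn
      have h2 : min η 1 * n ≤ |X n| :=
        (mul_le_mul_of_nonneg_right (min_le_left _ _) hn0.le).trans hn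
      rcases abs_cases (X n) with ⟨h3, -⟩ | ⟨h3, -⟩
      · left; linarith
      · right; linarith
    rcases frequently_or_distrib.1 hor with h1 | h1
    · exact ⟨1, by simp, h1⟩
    · exact ⟨-1, by simp, h1⟩
  -- This maximizes `|ε| * η - 2 * ε ^ 2`, with value `η ^ 2 / 8 = 4 * δ`; domination loses `2 * δ`,
  -- leaving growth rate `2 * δ`.
  set ε := s * (η / 4) with hεdef
  have hs2 : s ^ 2 = 1 := by rw [← sq_abs, hs, one_pow]
  have hε : |ε| ≤ 1 / 2 := by
    rw [hεdef, abs_mul, hs, one_mul, abs_of_pos (by positivity)]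
    linarith
  set δ := η ^ 2 / 32 with hδ
  have hδ0 : 0 < δ := by positivity
  have hA : (0 : ℝ) < Fintype.card Ω := by exact_mod_cast Fintype.card_pos
  have hbig : ∀ᶠ n : ℕ in atTop, Fintype.card Ω * B < Real.exp (2 * δ * n) :=
    (Real.tendsto_exp_atTop.comp (tendsto_natCast_atTop_atTop.const_mul_atTop
      (by positivity : 0 < 2 * δ))).eventually_gt_atTop _
  refine (hfreq.and_eventually
    ((eventually_wordProb_tilt_le hp hv a hε ω hδ0).and hbig)).mono ?_
  rintro n ⟨h1, h2, h3⟩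
  have hP := wordProb_pos (fun w b => (hp.1 w).1 b) [] (history ω n)
  have hge := wordProb_tilt_ge hp.1 v a hε ω n
  have hexp : 4 * δ * n ≤ ε * X n - 2 * ε ^ 2 * n := by
    have : ε ^ 2 = η ^ 2 / 16 := by rw [hεdef, mul_pow, hs2]; ring
    rw [this, hδ, hεdef]
    nlinarith
  have h4 := (mul_le_mul_of_nonneg_left (Real.exp_le_exp.2 hexp) hP.le).trans (hge.trans h2)
  rw [show 4 * δ * (n : ℝ) = 2 * δ * n + 2 * δ * n by ring, Real.exp_add, ← mul_assoc,
    mul_right_comm _ (Real.exp _) (wordProb lzProb _ _)] at h4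
  have h5 := le_of_mul_le_mul_right h4 (Real.exp_pos _)
  rw [lt_div_iff₀ hP]
  refine lt_of_mul_lt_mul_left ?_ hA.le
  calc _ = Fintype.card Ω * B * wordProb p [] (history ω n) := by ring
    _ < Real.exp (2 * δ * n) * wordProb p [] (history ω n) := mul_lt_mul_of_pos_right h3 hP
    _ ≤ _ := by rw [mul_comm]; exact h5

end Tilting

/-! ### Capital processes, banking, and strategies blind to the initial forecasts. -/

section Capital

variable {Ω : Type*} [Fintype Ω] [DecidableEq Ω] {k : ℕ}

lemma gain_lzStrategy [Nonempty Ω] {p : List Ω → Ω → ℝ} (hp : ∀ w, IsForecast (p w)) (w : List Ω)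
    (x : Ω) : gain p (lzStrategy p) w x = lzProb w x / p w x := by
  have h : ∀ a, lzProb w a / p w a * p w a = lzProb w a := fun a =>
    div_mul_cancel₀ _ ((hp w).1 a).ne'
  simp [gain, lzStrategy, mul_sub, Finset.sum_sub_distrib, h, (isForecast_lzProb w).2]

lemma capital_lzStrategy [Nonempty Ω] {p : List Ω → Ω → ℝ} (hp : ∀ w, IsForecast (p w))
    (ω : ℕ → Ω) (n : ℕ) :
    capital p (lzStrategy p) ω n =
      wordProb lzProb [] (history ω n) / wordProb p [] (history ω n) := by
  induction n with
  | zero => simp [capital, history, wordProb]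
  | succ n ih =>
    rw [capital, ih, gain_lzStrategy hp, history_succ, wordProb_append_singleton,
      wordProb_append_singleton, div_mul_div_comm]

lemma accounts_append_singleton (p α : List Ω → Ω → ℝ) (w : List Ω) (x : Ω) :
    accounts p α (w ++ [x]) = (accounts p α w).step p α x := by
  simp [accounts]

lemma accounts_past (p α : List Ω → Ω → ℝ) (w : List Ω) : (accounts p α w).past = w := by
  induction w using List.reverseRecOn with
  | nil => rfl
  | append_singleton w x ih =>
    rw [accounts_append_singleton, Accounts.step]
    split_ifs <;> simp [ih]

lemma accounts_active_pos {p α : List Ω → Ω → ℝ} (hg : ∀ w x, 0 < gain p α w x) (w : List Ω) :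
    0 < (accounts p α w).active := by
  induction w using List.reverseRecOn with
  | nil => simp [accounts]
  | append_singleton w x ih =>
    rw [accounts_append_singleton, Accounts.step]
    split_ifs
    · exact one_pos
    · exact mul_pos ih (hg _ _)

lemma accounts_storage_le_append (p α : List Ω → Ω → ℝ) (w : List Ω) (x : Ω) :
    (accounts p α w).storage ≤ (accounts p α (w ++ [x])).storage := by
  rw [accounts_append_singleton, Accounts.step]
  split_ifs <;> simp
  linarith

lemma monotone_storage (p α : List Ω → Ω → ℝ) (ω : ℕ → Ω) :
    Monotone fun n => (accounts p α (history ω n)).storage :=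
  monotone_nat_of_le_succ fun n => by
    rw [history_succ]; exact accounts_storage_le_append p α _ _

lemma storage_nonneg (p α : List Ω → Ω → ℝ) (ω : ℕ → Ω) (n : ℕ) :
    0 ≤ (accounts p α (history ω n)).storage := by
  simpa [history, accounts] using monotone_storage p α ω n.zero_le

lemma accounts_active_add_storage (p α : List Ω → Ω → ℝ) (w : List Ω) (x : Ω) :
    (accounts p α (w ++ [x])).active + (accounts p α (w ++ [x])).storage =
      (accounts p α w).active * gain p α w x + (accounts p α w).storage := by
  rw [accounts_append_singleton, Accounts.step, accounts_past]
  split_ifs <;> simp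
  ring

lemma gain_banked (p α : List Ω → Ω → ℝ) (w : List Ω) (x : Ω) :
    gain p (banked p α) w x = 1 + (accounts p α w).active /
      ((accounts p α w).active + (accounts p α w).storage) * (gain p α w x - 1) := by
  simp only [gain, banked, add_sub_cancel_left, Finset.mul_sum, mul_assoc]

lemma capital_banked {p α : List Ω → Ω → ℝ} (hg : ∀ w x, 0 < gain p α w x) (ω : ℕ → Ω) (n : ℕ) :
    capital p (banked p α) ω n = (accounts p α (history ω n)).active +
      (accounts p α (history ω n)).storage := by
  induction n with
  | zero => simp [capital, history, accounts]
  | succ n ih =>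
    have h0 := storage_nonneg p α ω n
    have h1 := accounts_active_pos hg (history ω n)
    rw [capital, ih, gain_banked, history_succ, accounts_active_add_storage]
    field_simp
    ring

lemma capital_pos {p α : List Ω → Ω → ℝ} (hg : ∀ w x, 0 < gain p α w x) (ω : ℕ → Ω) (n : ℕ) :
    0 < capital p α ω n := by
  induction n with
  | zero => exact one_pos
  | succ n ih => exact mul_pos ih (hg _ _)

lemma isPrudent_banked {p α : List Ω → Ω → ℝ} (hg : ∀ w x, 0 < gain p α w x) :
    IsPrudent p (banked p α) := fun ω n => by
  rw [capital_banked hg]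
  exact add_pos_of_pos_of_nonneg (accounts_active_pos hg _) (storage_nonneg p α ω n)

/-- As long as the capital of `α` is unbounded, gains are banked again and again. -/
lemma exists_storage_add_one_le {p α : List Ω → Ω → ℝ} (hg : ∀ w x, 0 < gain p α w x) {ω : ℕ → Ω}
    (h : ∀ B, ∃ᶠ n in atTop, B < capital p α ω n) (n : ℕ) :
    ∃ m, (accounts p α (history ω n)).storage + 1 ≤ (accounts p α (history ω m)).storage := by
  by_contra! hc
  have hstep : ∀ m, n ≤ m → ¬ 2 ≤ (accounts p α (history ω m)).active *
      gain p α (history ω m) (ω m) := by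
    intro m hm h2
    have h1 := hc (m + 1)
    have h3 := monotone_storage p α ω hm
    rw [history_succ, accounts_append_singleton, Accounts.step, accounts_past, if_pos h2] at h1
    simp only at h1 h3
    linarith
  -- While nothing is banked, the money in play stays proportional to the unbanked capital, so it
  -- must eventually exceed `2`.
  have hactive : ∀ m, n ≤ m → (accounts p α (history ω m)).active * capital p α ω n =
      (accounts p α (history ω n)).active * capital p α ω m := by
    intro m hm
    induction m, hm using Nat.le_induction with
    | base => rfl
    | succ m hm ih =>
      rw [history_succ, accounts_append_singleton, Accounts.step, accounts_past,
        if_neg (hstep m hm), capital, ← mul_assoc, ← ih]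
      ring
  have ha := accounts_active_pos hg (history ω n)
  have hn := capital_pos hg ω n
  obtain ⟨m, hlt, hm⟩ := ((h (2 * capital p α ω n / (accounts p α (history ω n)).active)
    ).and_eventually (eventually_gt_atTop n)).exists
  obtain ⟨m, rfl⟩ : ∃ m', m = m' + 1 := ⟨m - 1, by omega⟩
  rw [div_lt_iff₀ ha, mul_comm (capital p α ω (m + 1)), ← hactive _ hm.le] at hlt
  have h2 := hstep m (by omega)
  refine h2 (le_of_lt ?_)
  have := lt_of_mul_lt_mul_right hlt hn.le
  rwa [history_succ, accounts_append_singleton, Accounts.step, accounts_past, if_neg h2] at this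

lemma tendsto_capital_banked {p α : List Ω → Ω → ℝ} (hg : ∀ w x, 0 < gain p α w x) {ω : ℕ → Ω}
    (h : ∀ B, ∃ᶠ n in atTop, B < capital p α ω n) :
    Tendsto (capital p (banked p α) ω) atTop atTop := by
  have hN : ∀ N : ℕ, ∃ n, (N : ℝ) ≤ (accounts p α (history ω n)).storage := by
    intro N
    induction N with
    | zero => exact ⟨0, by simpa using storage_nonneg p α ω 0⟩
    | succ N ih =>
      obtain ⟨n, hn⟩ := ih
      obtain ⟨m, hm⟩ := exists_storage_add_one_le hg h n
      exact ⟨m, by push_cast; linarith⟩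
  have hst : Tendsto (fun n => (accounts p α (history ω n)).storage) atTop atTop :=
    tendsto_atTop_atTop_of_monotone (monotone_storage p α ω) fun b => by
      obtain ⟨N, hb⟩ := exists_nat_ge b
      obtain ⟨n, hn⟩ := hN N
      exact ⟨n, hb.trans hn⟩
  refine tendsto_atTop_mono (fun n => ?_) hst
  rw [capital_banked hg]
  linarith [accounts_active_pos hg (history ω n)]

theorem ensures_banked_lzStrategy [Nonempty Ω] {M : Ω → (Fin k → Ω) → ℝ} (hM : IsKernel M)
    {π : (Fin k → Ω) → ℝ} (hπ : IsStationary M π) {p : List Ω → Ω → ℝ}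
    (hp : FollowsKernel M p) : Ensures p (banked p (lzStrategy p)) (IsNormal M π) := by
  have hg : ∀ w x, 0 < gain p (lzStrategy p) w x := fun w x => by
    rw [gain_lzStrategy hp.1]
    exact div_pos ((isForecast_lzProb w).1 x) ((hp.1 w).1 x)
  refine ⟨isPrudent_banked hg, fun ω hω => tendsto_capital_banked hg fun B => ?_⟩
  simp only [capital_lzStrategy hp.1]
  by_contra hB
  refine hω (isNormal_of_tendsto_excess hM hπ hp fun v hv a => ?_)
  by_contra hlim
  exact hB (frequently_lt_lzProb_ratio hp hv hlim B)

/-- The indicator and the forecast both sum to `1`, so a constant vector is no bet at all. -/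
lemma gain_const {p α : List Ω → Ω → ℝ} {w : List Ω} (hp : IsForecast (p w)) {r : ℝ}
    (hα : ∀ a, α w a = r) (x : Ω) : gain p α w x = 1 := by
  simp [gain, hα, ← Finset.mul_sum, Finset.sum_sub_distrib, hp.2]

/-- The forecasts given by the kernel, preceded by Lempel–Ziv probabilities, against which the
Lempel–Ziv strategy does not bet. -/
noncomputable def lzKernelForecast (M : Ω → (Fin k → Ω) → ℝ) (w : List Ω) (a : Ω) : ℝ :=
  if h : k ≤ w.length then M a (fun j => w.get ⟨w.length - k + j, by omega⟩) else lzProb w a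

lemma followsKernel_lzKernelForecast [Nonempty Ω] {M : Ω → (Fin k → Ω) → ℝ} (hM : IsKernel M) :
    FollowsKernel M (lzKernelForecast M) := by
  constructor
  · intro w
    by_cases h : k ≤ w.length
    · have hw : lzKernelForecast M w =
          fun a => M a (fun j => w.get ⟨w.length - k + j, by omega⟩) :=
        funext fun a => dif_pos h
      exact hw ▸ hM _
    · have hw : lzKernelForecast M w = lzProb w := funext fun a => dif_neg h
      exact hw ▸ isForecast_lzProb w
  · intro u v a
    have h : k ≤ (u ++ List.ofFn v).length := by simp
    rw [lzKernelForecast, dif_pos h]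
    congr 1
    ext j
    simp

/-- On histories shorter than `k` the fictitious forecasts equal `lzProb`, so the bets are constant
and gain nothing against any forecasts; afterwards real and fictitious forecasts coincide. The two
capital processes are therefore identical. -/
theorem exists_ensures_isNormal [Nonempty Ω] {M : Ω → (Fin k → Ω) → ℝ} (hM : IsKernel M)
    {π : (Fin k → Ω) → ℝ} (hπ : IsStationary M π) :
    ∃ α : List Ω → Ω → ℝ, ∀ p : List Ω → Ω → ℝ, FollowsKernel M p →
      Ensures p α (IsNormal M π) := by
  have hq := followsKernel_lzKernelForecast hM
  refine ⟨banked (lzKernelForecast M) (lzStrategy (lzKernelForecast M)), fun p hp => ?_⟩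
  set q := lzKernelForecast M with hqdef
  have hgain : ∀ w x, gain p (banked q (lzStrategy q)) w x =
      gain q (banked q (lzStrategy q)) w x := by
    intro w x
    by_cases h : k ≤ w.length
    · have hpq : p w = q w := by
        ext a
        rw [eq_take_append_ofFn h, hp.2, hq.2]
      simp only [gain, hpq]
    · have hlz : ∀ a, lzStrategy q w a = 1 := fun a => by
        rw [lzStrategy, hqdef, lzKernelForecast, dif_neg h]
        exact div_self ((isForecast_lzProb w).1 a).ne'
      have hα : ∀ a, banked q (lzStrategy q) w a = _ := fun a => by
        rw [banked, hlz, mul_one]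
      rw [gain_const (hp.1 w) hα, gain_const (hq.1 w) hα]
  have hcap : ∀ ω n, capital p (banked q (lzStrategy q)) ω n =
      capital q (banked q (lzStrategy q)) ω n := by
    intro ω n
    induction n with
    | zero => rfl
    | succ n ih => rw [capital, capital, ih, hgain]
  obtain ⟨h1, h2⟩ := ensures_banked_lzStrategy hM hπ hq
  refine ⟨fun ω n => (hcap ω n).symm ▸ h1 ω n, fun ω hω => ?_⟩
  exact (h2 ω hω).congr fun n => (hcap ω n).symm

end Capital

end PredictiveGame

theorem mainTheorem1 {Ω : Type*} [Fintype Ω] [DecidableEq Ω] [Nonempty Ω] (k : ℕ)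
    (M : Ω → (Fin k → Ω) → ℝ) (hM : PredictiveGame.IsKernel M) :
    ∃ π : (Fin k → Ω) → ℝ,
      -- `π` is the stationary distribution of `M`, and it is strictly positive
      (PredictiveGame.IsStationary M π ∧ (∀ v, 0 < π v) ∧
        ∀ π' : (Fin k → Ω) → ℝ, PredictiveGame.IsStationary M π' → π' = π) ∧
      -- one strategy, depending on Reality's past moves only, serves against every Forecaster
      (∃ α : List Ω → Ω → ℝ, ∀ p : List Ω → Ω → ℝ, PredictiveGame.FollowsKernel M p →
        PredictiveGame.Ensures p α (PredictiveGame.IsNormal M π)) ∧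
      -- the Lempel–Ziv betting strategy with banked gains is such a strategy
      (∀ p : List Ω → Ω → ℝ, PredictiveGame.FollowsKernel M p →
        PredictiveGame.Ensures p (PredictiveGame.banked p (PredictiveGame.lzStrategy p))
          (PredictiveGame.IsNormal M π)) := by
  obtain ⟨π, hπ⟩ := PredictiveGame.exists_isStationary hM
  exact ⟨π, ⟨hπ, hπ.pos hM, fun π' hπ' => hπ.unique hM hπ'⟩,
    PredictiveGame.exists_ensures_isNormal hM hπ,
    fun p hp => PredictiveGame.ensures_banked_lzStrategy hM hπ hp⟩
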